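/- Let $K$ be an algebraically closed field of characteristic zero, let $\mathfrak{g}$ be a finite-dimensional semisimple Lie algebra over $K$, and for an element $a$ of a Lie ring $\mathfrak{R}$ put $C_{\mathfrak{R}}(a)=\{b\in\mathfrak{R}\mid [a,b]=0\}$. A Lie ring $\mathfrak{R}$ satisfies the C-condition if there are $a,b\in\mathfrak{R}$ with $C_{\mathfrak{R}}(a)\cap C_{\mathfrak{R}}(b)=\{0\}$. A Borel subalgebra of $\mathfrak{g}$ is a subalgebra of the form $\mathfrak{b}=\mathfrak{h}\oplus\bigoplus_{\alpha\in\Phi^+}\mathfrak{g}_\alpha$, where $\mathfrak{h}$ is a Cartan subalgebra of $\mathfrak{g}$ and $\Phi^+$ is a system of positive roots of $\mathfrak{g}$ with respect to $\mathfrak{h}$; a parabolic subalgebra of $\mathfrak{g}$ is a subalgebra that contains a Borel subalgebra. Let $\mathfrak{p}$ be a parabolic subalgebra of $\mathfrak{g}$. Then the Lie algebra $\mathfrak{p}$ satisfies the C-condition. More precisely, let $\mathfrak{b}\subseteq\mathfrak{p}$ be any Borel subalgebra, associated with $\mathfrak{h}$ and $\Phi^+$ as above. Then there are elements $x\in\mathfrak{h}$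 that are not in the kernel of any root of $\mathfrak{g}$. For every such $x$, and for every sum $y=\sum_{\alpha\in\Phi^+}e_\alpha$ with nonzero root vectors $e_\alpha\in\mathfrak{g}_\alpha$, one has $x,y\in\mathfrak{p}$, $C_{\mathfrak{g}}(x)=\mathfrak{h}$, $\mathfrak{h}\cap C_{\mathfrak{g}}(y)=\{0\}$, and therefore $C_{\mathfrak{p}}(x)\cap C_{\mathfrak{p}}(y)=\{0\}$. -/

import Mathlib

/-- The centralizer `C(a) = {b | [a, b] = 0}` of an element of a Lie ring. -/
def elementCentralizer {R : Type*} [LieRing R] (a : R) : Set R :=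
  {b : R | ⁅a, b⁆ = 0}

/-- A Lie ring satisfies the C-condition if two of its elements have centralizers with trivial
intersection. -/
def CCondition (R : Type*) [LieRing R] : Prop :=
  ∃ a b : R, elementCentralizer a ∩ elementCentralizer b = {0}

section Parabolic

variable {K L : Type*} [Field K] [LieRing L] [LieAlgebra K L] [Module.Finite K L] [CharZero K]

/-- `P` is a system of positive roots of `L` with respect to `H`: it contains exactly one of each
pair of opposite roots, and a root that is a sum of two elements of `P` is again in `P`.
(`H.root` is the finite set of nonzero weights of `H` on `L`.) -/
structure IsPositiveSystem (H : LieSubalgebra K L) [H.IsCartanSubalgebra]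
    (P : Finset (LieModule.Weight K H L)) : Prop where
  subset_root : P ⊆ H.root
  mem_or_neg_mem : ∀ α ∈ H.root, α ∈ P ∨ ∃ β ∈ P, (β : H → K) = -(α : H → K)
  neg_not_mem : ∀ α ∈ P, ∀ β ∈ P, (β : H → K) ≠ -(α : H → K)
  add_mem : ∀ α ∈ P, ∀ β ∈ P, ∀ γ ∈ H.root,
    (γ : H → K) = (α : H → K) + (β : H → K) → γ ∈ P

/-- `B` is the Borel subalgebra associated with the Cartan subalgebra `H` and the system `P` of
positive roots, that is, the sum of `H` and of the root spaces of the roots in `P`. -/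
structure IsBorelOf (B H : LieSubalgebra K L) [H.IsCartanSubalgebra]
    (P : Finset (LieModule.Weight K H L)) : Prop where
  isPositiveSystem : IsPositiveSystem H P
  toSubmodule_eq : B.toSubmodule =
    H.toSubmodule ⊔ ⨆ α ∈ P, (LieAlgebra.rootSpace H (α : H → K)).toSubmodule

/-- A Borel subalgebra (of a semisimple Lie algebra over an algebraically closed field of
characteristic zero) is the sum of a Cartan subalgebra and of the root spaces of a system of
positive roots. -/
def IsBorelSubalgebra (B : LieSubalgebra K L) : Prop :=
  ∃ (H : LieSubalgebra K L) (_ : H.IsCartanSubalgebra) (P : Finset (LieModule.Weight K H L)),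
    IsBorelOf B H P

/-- A parabolic subalgebra is a subalgebra that contains a Borel subalgebra. -/
def IsParabolicSubalgebra (p : LieSubalgebra K L) : Prop :=
  ∃ B : LieSubalgebra K L, IsBorelSubalgebra B ∧ B ≤ p

end Parabolic

/-! In the root decomposition, `H` acts on each root space by the scalar `α`. If no root vanishes at
`x`, then `x` kills only the zero weight space, which is `H`. If `h ∈ H` commutes with `∑ e α`,
independence of the root spaces gives `α h = 0` for all positive `α`, hence for all roots, and the
roots have no common zero. So the two centralizers already meet trivially in `L`, and this passes to
`p`. -/

open LieAlgebra LieModule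

section

variable {K L : Type*} [Field K] [IsAlgClosed K] [CharZero K]
  [LieRing L] [LieAlgebra K L] [Module.Finite K L]
  (H : LieSubalgebra K L) [H.IsCartanSubalgebra]

/-- There are elements of a Cartan subalgebra at which no root vanishes. -/
theorem exists_forall_root_apply_ne_zero : ∃ x : H, ∀ α ∈ H.root, α x ≠ 0 := by
  -- A vector space over an infinite field is not a finite union of hyperplanes.
  obtain ⟨x, hx⟩ := Module.Dual.exists_forall_ne_zero_of_forall_exists
    (fun α : H.root ↦ Weight.toLinear K H L α.1) fun α ↦ by
      obtain ⟨α, hα⟩ := α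
      by_contra! h
      exact (Finset.mem_filter.mp hα).2 (funext h)
  exact ⟨x, fun α hα ↦ hx ⟨α, hα⟩⟩

variable [LieAlgebra.IsSemisimple K L] {H}

/-- The centralizer of a regular element of a Cartan subalgebra is the Cartan subalgebra. -/
theorem elementCentralizer_eq_of_forall_root_apply_ne_zero {x : H}
    (hx : ∀ α ∈ H.root, α x ≠ 0) : elementCentralizer (x : L) = (H : Set L) := by
  ext b
  refine ⟨fun hb ↦ ?_, fun hb ↦ ?_⟩
  · have hb' : ⁅x, b⁆ = 0 := hb
    have htop : b ∈ ⨆ α : Weight K H L, (rootSpace H (α : H → K)).toSubmodule := by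
      rw [← LieSubmodule.iSup_toSubmodule, iSup_genWeightSpace_eq_top']
      trivial
    obtain ⟨f, hf, hfb⟩ := (Submodule.mem_iSup_iff_exists_finsupp _ _).mp htop
    have hind : iSupIndep fun α : Weight K H L ↦ (rootSpace H (α : H → K)).toSubmodule :=
      (LieSubmodule.iSupIndep_toSubmodule).mpr (iSupIndep_genWeightSpace' K H L)
    have hsum : ∑ α ∈ f.support, α x • f α = 0 := by
      rw [← hb', ← hfb, Finsupp.sum, lie_sum]
      -- Root spaces are generalized weight spaces; semisimplicity makes them genuine eigenspaces.
      exact Finset.sum_congr rfl fun α _ ↦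
        (IsKilling.lie_eq_smul_of_mem_rootSpace (hf α) x).symm
    have hzero : ∀ α ∈ f.support, α x • f α = 0 :=
      (iSupIndep_iff_finsetSum_eq_zero_imp_eq_zero _).mp hind f.support _
        (fun α _ ↦ Submodule.smul_mem _ _ (hf α)) hsum
    rw [← hfb]
    refine H.sum_mem fun α hα ↦ ?_
    have hαx : α x = 0 :=
      (smul_eq_zero.mp (hzero α hα)).resolve_right (Finsupp.mem_support_iff.mp hα)
    have hα0 : (α : H → K) = 0 := by
      by_contra h
      exact hx α (Finset.mem_filter.mpr ⟨Finset.mem_univ _, h⟩) hαx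
    have := hf α
    rw [hα0, rootSpace_zero_eq] at this
    exact this
  -- Here `H` is abelian, since `L` is semisimple.
  · have := congrArg (Subtype.val : H → L) (trivial_lie_zero H H x ⟨b, hb⟩)
    exact this

/-- An element of a Cartan subalgebra killed by every positive root vanishes. -/
theorem IsPositiveSystem.eq_zero_of_forall_apply_eq_zero {P : Finset (Weight K H L)}
    (hP : IsPositiveSystem H P) {h : H} (hh : ∀ α ∈ P, α h = 0) : h = 0 := by
  have hmem : h ∈ ⨅ α : Weight K H L, α.ker := by
    simp only [Submodule.mem_iInf]
    intro α
    change α h = 0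
    by_cases hα : α.IsZero
    · exact congrFun hα h
    · obtain hα | ⟨β, hβ, hβα⟩ :=
        hP.mem_or_neg_mem α (Finset.mem_filter.mpr ⟨Finset.mem_univ _, hα⟩)
      · exact hh α hα
      · simpa [hh β hβ] using congrFun hβα h
  rwa [IsKilling.iInf_ker_weight_eq_bot] at hmem

/-- A sum of nonzero root vectors, one for each positive root, commutes with no nonzero element of
the Cartan subalgebra. -/
theorem IsPositiveSystem.inter_elementCentralizer_sum {P : Finset (Weight K H L)}
    (hP : IsPositiveSystem H P) {e : Weight K H L → L}
    (he : ∀ α ∈ P, e α ∈ rootSpace H (α : H → K) ∧ e α ≠ 0) :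
    (H : Set L) ∩ elementCentralizer (∑ α ∈ P, e α) = {0} := by
  refine Set.eq_singleton_iff_unique_mem.mpr ⟨⟨H.zero_mem, lie_zero _⟩, ?_⟩
  rintro h ⟨hh, hc⟩
  lift h to H using hh
  have hind : iSupIndep fun α : Weight K H L ↦ (rootSpace H (α : H → K)).toSubmodule :=
    (LieSubmodule.iSupIndep_toSubmodule).mpr (iSupIndep_genWeightSpace' K H L)
  have hsum : ∑ α ∈ P, α h • e α = 0 := by
    have hc' : ⁅(h : L), ∑ α ∈ P, e α⁆ = 0 := by rw [← lie_skew, hc, neg_zero]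
    rw [← hc', lie_sum]
    exact Finset.sum_congr rfl fun α hα ↦
      (IsKilling.lie_eq_smul_of_mem_rootSpace (he α hα).1 h).symm
  have hzero : ∀ α ∈ P, α h • e α = 0 :=
    (iSupIndep_iff_finsetSum_eq_zero_imp_eq_zero _).mp hind P _
      (fun α hα ↦ Submodule.smul_mem _ _ (he α hα).1) hsum
  rw [hP.eq_zero_of_forall_apply_eq_zero fun α hα ↦
    (smul_eq_zero.mp (hzero α hα)).resolve_right (he α hα).2]
  rfl

end

theorem IsBorelOf.cartan_le {K L : Type*} [Field K] [LieRing L] [LieAlgebra K L]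
    [Module.Finite K L] [CharZero K] {B H : LieSubalgebra K L} [H.IsCartanSubalgebra]
    {P : Finset (Weight K H L)} (hB : IsBorelOf B H P) : H ≤ B := by
  rw [← LieSubalgebra.toSubmodule_le_toSubmodule, hB.toSubmodule_eq]
  exact le_sup_left

theorem IsBorelOf.rootSpace_le {K L : Type*} [Field K] [LieRing L] [LieAlgebra K L]
    [Module.Finite K L] [CharZero K] {B H : LieSubalgebra K L} [H.IsCartanSubalgebra]
    {P : Finset (Weight K H L)} (hB : IsBorelOf B H P) {α : Weight K H L} (hα : α ∈ P) :
    (rootSpace H (α : H → K)).toSubmodule ≤ B.toSubmodule := by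
  rw [hB.toSubmodule_eq]
  exact le_sup_of_le_right (le_iSup₂_of_le α hα le_rfl)

/-- Elements whose centralizers in `L` meet trivially have centralizers meeting trivially in every
subalgebra containing them. -/
theorem elementCentralizer_inter_eq_of_subalgebra {K L : Type*} [CommRing K] [LieRing L]
    [LieAlgebra K L] {p : LieSubalgebra K L} {x y : p}
    (h : elementCentralizer (x : L) ∩ elementCentralizer (y : L) = {0}) :
    elementCentralizer x ∩ elementCentralizer y = {0} := by
  refine Set.eq_singleton_iff_unique_mem.mpr ⟨⟨lie_zero _, lie_zero _⟩, ?_⟩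
  rintro z ⟨hx, hy⟩
  have hz : (z : L) ∈ elementCentralizer (x : L) ∩ elementCentralizer (y : L) :=
    ⟨congrArg Subtype.val hx, congrArg Subtype.val hy⟩
  rw [h] at hz
  exact Subtype.ext hz

theorem mainTheorem6 {K L : Type*} [Field K] [IsAlgClosed K] [CharZero K]
    [LieRing L] [LieAlgebra K L] [Module.Finite K L] [LieAlgebra.IsSemisimple K L]
    (p : LieSubalgebra K L) (hp : IsParabolicSubalgebra p) :
    CCondition p ∧
    ∀ (B H : LieSubalgebra K L) [H.IsCartanSubalgebra] (P : Finset (LieModule.Weight K H L)),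
      IsBorelOf B H P → B ≤ p →
      (∃ x : H, ∀ α ∈ H.root, α x ≠ 0) ∧
      (∀ x : H, (∀ α ∈ H.root, α x ≠ 0) →
        ∀ e : LieModule.Weight K H L → L,
          (∀ α ∈ P, e α ∈ LieAlgebra.rootSpace H (α : H → K) ∧ e α ≠ 0) →
          elementCentralizer (x : L) = (H : Set L) ∧
          (H : Set L) ∩ elementCentralizer (∑ α ∈ P, e α) = {0} ∧
          ∃ (hx : (x : L) ∈ p) (hy : (∑ α ∈ P, e α) ∈ p),
            elementCentralizer (⟨x, hx⟩ : p) ∩ elementCentralizer (⟨∑ α ∈ P, e α, hy⟩ : p)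
              = {0}) := by
  have key : ∀ (B H : LieSubalgebra K L) [H.IsCartanSubalgebra]
      (P : Finset (LieModule.Weight K H L)), IsBorelOf B H P → B ≤ p →
      (∃ x : H, ∀ α ∈ H.root, α x ≠ 0) ∧
      (∀ x : H, (∀ α ∈ H.root, α x ≠ 0) →
        ∀ e : LieModule.Weight K H L → L,
          (∀ α ∈ P, e α ∈ LieAlgebra.rootSpace H (α : H → K) ∧ e α ≠ 0) →
          elementCentralizer (x : L) = (H : Set L) ∧
          (H : Set L) ∩ elementCentralizer (∑ α ∈ P, e α) = {0} ∧
          ∃ (hx : (x : L) ∈ p) (hy : (∑ α ∈ P, e α) ∈ p),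
            elementCentralizer (⟨x, hx⟩ : p) ∩ elementCentralizer (⟨∑ α ∈ P, e α, hy⟩ : p)
              = {0}) := by
    intro B H _ P hB hBp
    refine ⟨exists_forall_root_apply_ne_zero H, fun x hx e he ↦ ?_⟩
    have h₁ := elementCentralizer_eq_of_forall_root_apply_ne_zero hx
    have h₂ := hB.isPositiveSystem.inter_elementCentralizer_sum he
    exact ⟨h₁, h₂, hBp (hB.cartan_le x.2),
      p.sum_mem fun α hα ↦ hBp (hB.rootSpace_le hα (he α hα).1),
      elementCentralizer_inter_eq_of_subalgebra (h₁ ▸ h₂)⟩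
  refine ⟨?_, key⟩
  obtain ⟨B, ⟨H, _, P, hB⟩, hBp⟩ := hp
  obtain ⟨⟨x, hx⟩, h⟩ := key B H P hB hBp
  -- Weight spaces are nonzero by definition; only the values of `e` on `P` matter.
  choose e he using fun α : LieModule.Weight K H L ↦ α.exists_ne_zero
  obtain ⟨-, -, hxp, hyp, hxy⟩ := h x hx e fun α _ ↦ he α
  exact ⟨_, _, hxy⟩
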